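/- Let $X$ be a compact Hausdorff space, and let $K(X)$ denote the Grothendieck group of the monoid (under direct sum) of isomorphism classes of real vector bundles of finite, locally constant rank over $X$. Let $H_1,H_2$ be locally trivial bundles of real Banach spaces over $X$ (with Banach spaces $F_1$, $F_2$ as typical fibres, and with transition functions continuous in the operator norm). Let $B:H_1\to H_2$ be a bundle map over $X$, i.e. a fibrewise continuous linear map which in local trivializations depends continuously, in the operator norm, on the point of $X$, and suppose that $B_x:H_1|_x\to H_2|_x$ is Fredholm for every $x\in X$. Let $V$ be a finite-dimensional real normed space (e.g. $V=\mathbb{R}^n$) and $C:V\times X\to H_2$ a continuous fibrewise linear map over $X$. Put $\begin{bmatrix}B&C\end{bmatrix}:H_1\oplus (V\times X)\to H_2$, $(a,v)\mapsto Ba+Cv$. For a bundle map $T:H\to H_2$, global auxiliary data for $T$ are a space $W=\mathbb{R}^k$, $k\ge 0$, and a continuous fibrewise linear map $\pi:W\times X\to H_2$ over $X$ such that $\begin{bmatrix}T_x&\pi_x\end{bmatrix}:H|_x\oplus W\to H_2|_x$ is surjective for every $x\in X$. We say that the index bundle $\mathrm{ind}(T)\in K(X)$ is defined if such data exist and if for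 all such data $\ker\begin{bmatrix}T&\pi\end{bmatrix}=\bigcup_{x}\ker\begin{bmatrix}T_x&\pi_x\end{bmatrix}$, with the subspace topology from $H\oplus (W\times X)$, is a vector bundle of finite rank over $X$ and the class $$\mathrm{ind}(T)=[\ker\begin{bmatrix}T&\pi\end{bmatrix}]-[W\times X]\in K(X)$$ is the same for all such data. Then $\begin{bmatrix}B&C\end{bmatrix}$ is a bundle map that is Fredholm on each fibre, the index bundles $\mathrm{ind}(B)$ and $\mathrm{ind}(\begin{bmatrix}B&C\end{bmatrix})$ are defined, and $$\mathrm{ind}(\begin{bmatrix}B&C\end{bmatrix})=\mathrm{ind}(B)+[V]\in K(X),$$ where $[V]$ is the class of the trivial bundle $V\times X$. -/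

import Mathlib

open Bundle

universe u v

namespace KTheory

/-! ### Finite-rank real vector bundles and their isomorphism classes -/

theorem continuous_induced_comp {A Y Z : Type*} {tY : TopologicalSpace Y} {tZ : TopologicalSpace Z}
    {f : A → Y} {h : A → Z} (g : Y → Z) (hg : Continuous g) (hh : ∀ a, h a = g (f a)) :
    @Continuous A Z (TopologicalSpace.induced f tY) tZ h := by
  obtain rfl : h = g ∘ f := funext hh
  exact @Continuous.comp A Y Z (TopologicalSpace.induced f tY) _ _ _ _ hg continuous_induced_dom

/-- A family of real vector spaces over `X`: vector spaces `Fib x` indexed by the points of `X`,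
and a topology on the total space `⋃ x, Fib x` for which the projection to `X` is continuous.
(The first argument of `TotalSpace` is a dummy.) -/
structure Family (X : Type v) [TopologicalSpace X] : Type (max v (u + 1)) where
  Fib : X → Type u
  [addCommGroup : ∀ x, AddCommGroup (Fib x)]
  [module : ∀ x, Module ℝ (Fib x)]
  [top : TopologicalSpace (TotalSpace Unit Fib)]
  continuous_proj : Continuous (TotalSpace.proj : TotalSpace Unit Fib → X)

attribute [instance] Family.addCommGroup Family.module Family.top

variable {X : Type v} [TopologicalSpace X]

namespace Family

/-- The total space of a family of vector spaces. -/
abbrev Total (E : Family.{u} X) : Type (max v u) := TotalSpace Unit E.Fib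

/-- Local triviality with finite-dimensional fibres: every point has an open neighbourhood `U`
over which the family is isomorphic to `U × F`, by a fibrewise linear homeomorphism over `U`, for
some finite-dimensional `F`. The dimension of `F` may depend on the point. -/
def IsLocallyTrivial (E : Family.{u} X) : Prop :=
  ∀ x₀ : X, ∃ U : Set X, IsOpen U ∧ x₀ ∈ U ∧
    ∃ (F : Type) (_ : NormedAddCommGroup F) (_ : NormedSpace ℝ F) (_ : FiniteDimensional ℝ F)
      (φ : ∀ x : U, E.Fib x ≃ₗ[ℝ] F),
      Continuous (fun p : {p : E.Total // p.proj ∈ U} => φ ⟨p.1.proj, p.2⟩ p.1.snd) ∧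
      Continuous (fun q : U × F => (⟨q.1, (φ q.1).symm q.2⟩ : E.Total))

/-- Two families are isomorphic if there is a fibrewise linear homeomorphism over `X` between
their total spaces. -/
def Iso (E E' : Family.{u} X) : Prop :=
  ∃ φ : ∀ x, E.Fib x ≃ₗ[ℝ] E'.Fib x,
    Continuous (fun p : E.Total => (⟨p.proj, φ p.proj p.snd⟩ : E'.Total)) ∧
    Continuous (fun p : E'.Total => (⟨p.proj, (φ p.proj).symm p.snd⟩ : E.Total))

/-- The direct (Whitney) sum of two families, topologized as the fibre product over `X`. -/
def sum (E E' : Family.{u} X) : Family.{u} X where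
  Fib x := E.Fib x × E'.Fib x
  top := TopologicalSpace.induced
    (fun p => ((⟨p.proj, p.snd.1⟩ : E.Total), (⟨p.proj, p.snd.2⟩ : E'.Total))) inferInstance
  continuous_proj := continuous_induced_comp (fun q : E.Total × E'.Total => q.1.proj)
    (E.continuous_proj.comp continuous_fst) fun _ => rfl

/-- The trivial family `X × V`. -/
def trivial (X : Type v) [TopologicalSpace X] (V : Type) [NormedAddCommGroup V]
    [NormedSpace ℝ V] : Family.{u} X where
  Fib _ := ULift.{u} V
  top := TopologicalSpace.induced (fun p => (p.proj, p.snd.down)) inferInstance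
  continuous_proj := continuous_induced_comp (fun q : X × V => q.1) continuous_fst fun _ => rfl

theorem continuous_sum_iff {E E' : Family.{u} X} {Y : Type*} [TopologicalSpace Y]
    {f : Y → (E.sum E').Total} :
    Continuous f ↔ Continuous (fun y => (⟨(f y).proj, (f y).snd.1⟩ : E.Total)) ∧
      Continuous (fun y => (⟨(f y).proj, (f y).snd.2⟩ : E'.Total)) := by
  refine continuous_induced_rng.trans ?_
  rw [continuous_prodMk.symm]
  rfl

theorem continuous_sum_fst {E E' : Family.{u} X} :
    Continuous (fun p : (E.sum E').Total => (⟨p.proj, p.snd.1⟩ : E.Total)) :=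
  (continuous_sum_iff.1 continuous_id).1

theorem continuous_sum_snd {E E' : Family.{u} X} :
    Continuous (fun p : (E.sum E').Total => (⟨p.proj, p.snd.2⟩ : E'.Total)) :=
  (continuous_sum_iff.1 continuous_id).2

theorem continuous_trivial_iff {V : Type} [NormedAddCommGroup V] [NormedSpace ℝ V]
    {Y : Type*} [TopologicalSpace Y] {f : Y → (trivial.{u} X V).Total} :
    Continuous f ↔ Continuous (fun y => (f y).proj) ∧
      Continuous (fun y => ((f y).snd : ULift V).down) := by
  refine continuous_induced_rng.trans ?_
  rw [continuous_prodMk.symm]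
  rfl

theorem isLocallyTrivial_trivial (V : Type) [NormedAddCommGroup V] [NormedSpace ℝ V]
    [FiniteDimensional ℝ V] : (trivial.{u} X V).IsLocallyTrivial := by
  intro x₀
  refine ⟨Set.univ, isOpen_univ, Set.mem_univ _, V, inferInstance, inferInstance, inferInstance,
    fun _ => ULift.moduleEquiv, ?_, ?_⟩
  · exact (continuous_trivial_iff.1 continuous_subtype_val).2
  · refine continuous_trivial_iff.2 ⟨?_, ?_⟩
    · exact continuous_subtype_val.comp continuous_fst
    · exact continuous_snd

theorem IsLocallyTrivial.sum {E E' : Family.{u} X} (hE : E.IsLocallyTrivial)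
    (hE' : E'.IsLocallyTrivial) : (E.sum E').IsLocallyTrivial := by
  intro x₀
  obtain ⟨U, hU, hxU, F, i₁, i₂, i₃, φ, hφ, hφs⟩ := hE x₀
  obtain ⟨U', hU', hxU', F', i₁', i₂', i₃', φ', hφ', hφs'⟩ := hE' x₀
  refine ⟨U ∩ U', hU.inter hU', ⟨hxU, hxU'⟩, F × F', inferInstance, inferInstance, inferInstance,
    fun x => (φ ⟨x, x.2.1⟩).prodCongr (φ' ⟨x, x.2.2⟩), ?_, ?_⟩
  · refine Continuous.prodMk ?_ ?_
    · exact hφ.comp (Continuous.subtype_mk (continuous_sum_fst.comp continuous_subtype_val)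
        fun p => p.2.1)
    · exact hφ'.comp (Continuous.subtype_mk (continuous_sum_snd.comp continuous_subtype_val)
        fun p => p.2.2)
  · refine continuous_sum_iff.2 ⟨?_, ?_⟩
    · exact hφs.comp (Continuous.prodMk
        (Continuous.subtype_mk (continuous_subtype_val.comp continuous_fst) fun q => q.1.2.1)
        (continuous_fst.comp continuous_snd))
    · exact hφs'.comp (Continuous.prodMk
        (Continuous.subtype_mk (continuous_subtype_val.comp continuous_fst) fun q => q.1.2.2)
        (continuous_snd.comp continuous_snd))

theorem Iso.refl (E : Family.{u} X) : E.Iso E :=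
  ⟨fun _ => LinearEquiv.refl ℝ _, continuous_id, continuous_id⟩

theorem Iso.symm {E E' : Family.{u} X} (h : E.Iso E') : E'.Iso E := by
  obtain ⟨φ, h₁, h₂⟩ := h
  exact ⟨fun x => (φ x).symm, h₂, h₁⟩

theorem Iso.trans {E E' E'' : Family.{u} X} (h : E.Iso E') (h' : E'.Iso E'') : E.Iso E'' := by
  obtain ⟨φ, h₁, h₂⟩ := h
  obtain ⟨φ', h₁', h₂'⟩ := h'
  exact ⟨fun x => (φ x).trans (φ' x), h₁'.comp h₁, h₂.comp h₂'⟩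

theorem Iso.sum {E₁ E₁' E₂ E₂' : Family.{u} X} (h₁ : E₁.Iso E₁') (h₂ : E₂.Iso E₂') :
    (E₁.sum E₂).Iso (E₁'.sum E₂') := by
  obtain ⟨φ, a, b⟩ := h₁
  obtain ⟨ψ, c, d⟩ := h₂
  exact ⟨fun x => (φ x).prodCongr (ψ x),
    continuous_sum_iff.2 ⟨a.comp continuous_sum_fst, c.comp continuous_sum_snd⟩,
    continuous_sum_iff.2 ⟨b.comp continuous_sum_fst, d.comp continuous_sum_snd⟩⟩

theorem sum_comm_iso (E E' : Family.{u} X) : (E.sum E').Iso (E'.sum E) :=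
  ⟨fun _ => LinearEquiv.prodComm ℝ _ _,
    continuous_sum_iff.2 ⟨continuous_sum_snd, continuous_sum_fst⟩,
    continuous_sum_iff.2 ⟨continuous_sum_snd, continuous_sum_fst⟩⟩

theorem sum_assoc_iso (E E' E'' : Family.{u} X) :
    ((E.sum E').sum E'').Iso (E.sum (E'.sum E'')) := by
  have a₁ := (continuous_sum_fst (E := E.sum E') (E' := E''))
  have a₂ := (continuous_sum_snd (E := E.sum E') (E' := E''))
  have b₁ := (continuous_sum_fst (E := E) (E' := E'.sum E''))
  have b₂ := (continuous_sum_snd (E := E) (E' := E'.sum E''))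
  refine ⟨fun _ => LinearEquiv.prodAssoc ℝ _ _ _, ?_, ?_⟩
  · refine continuous_sum_iff.2 ⟨?_, continuous_sum_iff.2 ⟨?_, a₂⟩⟩
    · exact (continuous_sum_fst (E := E) (E' := E')).comp a₁
    · exact (continuous_sum_snd (E := E) (E' := E')).comp a₁
  · refine continuous_sum_iff.2 ⟨continuous_sum_iff.2 ⟨b₁, ?_⟩, ?_⟩
    · exact (continuous_sum_fst (E := E') (E' := E'')).comp b₂
    · exact (continuous_sum_snd (E := E') (E' := E'')).comp b₂

theorem zero_sum_iso (E : Family.{u} X) : ((trivial.{u} X PUnit).sum E).Iso E := by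
  refine ⟨fun _ => ⟨LinearMap.snd ℝ _ _, fun v => (0, v), ?_, fun _ => rfl⟩,
    continuous_sum_snd, continuous_sum_iff.2 ⟨continuous_trivial_iff.2
      ⟨E.continuous_proj, continuous_const⟩, continuous_id⟩⟩
  rintro ⟨⟨⟩, v⟩
  rfl

end Family

/-- A real vector bundle of finite rank over `X`; the rank is only locally constant. -/
structure VectBundle (X : Type v) [TopologicalSpace X] : Type (max v (u + 1)) where
  toFamily : Family.{u} X
  isLocallyTrivial : toFamily.IsLocallyTrivial

/-- Isomorphism of vector bundles. -/
instance VectBundle.setoid (X : Type v) [TopologicalSpace X] : Setoid (VectBundle.{u} X) where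
  r E E' := E.toFamily.Iso E'.toFamily
  iseqv := ⟨fun E => Family.Iso.refl E.toFamily, fun h => h.symm, fun h h' => h.trans h'⟩

/-- The set of isomorphism classes of finite-rank real vector bundles over `X`. -/
def Vect (X : Type v) [TopologicalSpace X] : Type (max v (u + 1)) :=
  Quotient (VectBundle.setoid.{u} X)

/-- The class of the zero bundle. -/
noncomputable instance Vect.zero : Zero (Vect.{u} X) :=
  ⟨Quotient.mk _ ⟨Family.trivial X PUnit, Family.isLocallyTrivial_trivial PUnit⟩⟩

/-- Addition of classes is the direct sum. -/
instance Vect.add : Add (Vect.{u} X) :=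
  ⟨Quotient.map₂ (fun E E' => ⟨E.1.sum E'.1, E.2.sum E'.2⟩)
    fun _ _ h _ _ h' => Family.Iso.sum h h'⟩

/-- `Vect X` is a commutative monoid under direct sum. -/
noncomputable instance Vect.addCommMonoid : AddCommMonoid (Vect.{u} X) where
  add_assoc := by
    rintro ⟨E⟩ ⟨E'⟩ ⟨E''⟩
    exact Quotient.sound (Family.sum_assoc_iso E.1 E'.1 E''.1)
  zero_add := by
    rintro ⟨E⟩
    exact Quotient.sound (Family.zero_sum_iso E.1)
  add_zero := by
    rintro ⟨E⟩
    exact Quotient.sound ((Family.sum_comm_iso _ _).trans (Family.zero_sum_iso E.1))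
  add_comm := by
    rintro ⟨E⟩ ⟨E'⟩
    exact Quotient.sound (Family.sum_comm_iso E.1 E'.1)
  nsmul := nsmulRec

/-- The (real) topological `K`-group of `X`: the Grothendieck group of the monoid of isomorphism
classes of finite-rank real vector bundles. -/
abbrev K (X : Type v) [TopologicalSpace X] : Type (max v (u + 1)) :=
  Algebra.GrothendieckAddGroup (Vect.{u} X)

/-- The class in `K X` of a family of vector spaces that is a vector bundle. -/
noncomputable def K.mk (E : Family.{u} X) (h : E.IsLocallyTrivial) : K.{u} X :=
  Algebra.GrothendieckAddGroup.of (Quotient.mk _ ⟨E, h⟩ : Vect.{u} X)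

/-- The class `[V]` of the trivial bundle `X × V`. -/
noncomputable def K.triv (X : Type v) [TopologicalSpace X] (V : Type) [NormedAddCommGroup V] [NormedSpace ℝ V]
    [FiniteDimensional ℝ V] : K.{u} X :=
  K.mk (Family.trivial X V) (Family.isLocallyTrivial_trivial V)

/-! ### Fredholm maps of Banach bundles and the index bundle -/

section Index

variable {F₁ : Type*} [NormedAddCommGroup F₁] [NormedSpace ℝ F₁]
  {E₁ : X → Type u} [∀ x, AddCommGroup (E₁ x)] [∀ x, Module ℝ (E₁ x)]
  [∀ x, TopologicalSpace (E₁ x)] [TopologicalSpace (TotalSpace F₁ E₁)]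
  [FiberBundle F₁ E₁]
  {F₂ : Type*} [NormedAddCommGroup F₂] [NormedSpace ℝ F₂]
  {E₂ : X → Type*} [∀ x, AddCommGroup (E₂ x)] [∀ x, Module ℝ (E₂ x)]
  [∀ x, TopologicalSpace (E₂ x)] [TopologicalSpace (TotalSpace F₂ E₂)]
  [FiberBundle F₂ E₂]

variable (F₁ F₂) in
/-- A Fredholm bundle map: a morphism of Banach bundles `E₁ → E₂` over `X`, that is, a section
of the bundle of continuous linear maps, continuous for the operator norm in local
trivializations, which is Fredholm on each fibre. -/
structure IsFredholmBundleMap [VectorBundle ℝ F₁ E₁] [VectorBundle ℝ F₂ E₂]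
    [∀ x, IsTopologicalAddGroup (E₂ x)] [∀ x, ContinuousSMul ℝ (E₂ x)]
    (B : ∀ x, E₁ x →L[ℝ] E₂ x) : Prop where
  continuous : Continuous fun x =>
    TotalSpace.mk' (F₁ →L[ℝ] F₂) (E := fun x => E₁ x →L[ℝ] E₂ x) x (B x)
  isFredholm : ∀ x, (B x).IsFredholm

variable (F₂) in
/-- A linear bundle map `X × V → E₂`, for finite-dimensional `V`: a fibrewise linear map which is
continuous on the total space. -/
def IsLinearBundleMap {V : Type} [NormedAddCommGroup V] [NormedSpace ℝ V]
    (C : ∀ x, V →L[ℝ] E₂ x) : Prop :=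
  Continuous fun p : X × V => TotalSpace.mk' F₂ p.1 (C p.1 p.2)

/-- The bundle map `[B C] : E₁ ⊕ (X × V) → E₂`, `(a, v) ↦ B a + C v`. -/
def row [∀ x, IsTopologicalAddGroup (E₂ x)] {V : Type} [NormedAddCommGroup V] [NormedSpace ℝ V]
    (B : ∀ x, E₁ x →L[ℝ] E₂ x) (C : ∀ x, V →L[ℝ] E₂ x) (x : X) :
    (E₁ ×ᵇ Bundle.Trivial X V) x →L[ℝ] E₂ x :=
  (B x).coprod (C x)

variable (F₁) in
/-- The family of kernels `⋃ x, ker (T x)`, with the subspace topology from the total space of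
`E₁`. -/
def kerFamily (T : ∀ x, E₁ x →L[ℝ] E₂ x) : Family.{u} X where
  Fib x := LinearMap.ker (T x : E₁ x →ₗ[ℝ] E₂ x)
  top := TopologicalSpace.induced (fun p => TotalSpace.mk' F₁ p.proj (p.snd : E₁ p.proj))
    inferInstance
  continuous_proj := continuous_induced_comp _ (FiberBundle.continuous_proj F₁ E₁) fun _ => rfl

variable [∀ x, IsTopologicalAddGroup (E₂ x)]

variable (F₂) in
/-- Global auxiliary data for `B`: a finite-dimensional space `W = ℝᵏ` and a continuous family of
linear maps `map x : W → E₂ x` such that `[B map]` is surjective on each fibre. -/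
structure AuxData (B : ∀ x, E₁ x →L[ℝ] E₂ x) where
  k : ℕ
  map : ∀ x, EuclideanSpace ℝ (Fin k) →L[ℝ] E₂ x
  isLinearBundleMap : IsLinearBundleMap F₂ map
  surjective : ∀ x, Function.Surjective (row B map x)

variable (F₁) in
/-- The family of kernels `ker [B map]` in `E₁ ⊕ (X × W)`. -/
noncomputable def AuxData.kernel {B : ∀ x, E₁ x →L[ℝ] E₂ x} (A : AuxData F₂ B) : Family.{u} X :=
  kerFamily (F₁ × EuclideanSpace ℝ (Fin A.k)) (row B A.map)

variable (F₁ F₂) in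
/-- `ξ ∈ K X` is the index bundle of `B`: global auxiliary data `(W, map)` for `B` exist, and for
every choice of them the kernels `ker [B map]` form a vector bundle with
`[ker [B map]] - [X × W] = ξ`. -/
def IsIndex (B : ∀ x, E₁ x →L[ℝ] E₂ x) (ξ : K.{u} X) : Prop :=
  Nonempty (AuxData F₂ B) ∧
    ∀ A : AuxData F₂ B, ∃ h : (A.kernel F₁).IsLocallyTrivial,
      K.mk (A.kernel F₁) h - K.triv X (EuclideanSpace ℝ (Fin A.k)) = ξ

open Classical in
variable (F₁ F₂) in
/-- The index bundle `ind B ∈ K X` (with the value `0` if it is not defined). -/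
noncomputable def ind (B : ∀ x, E₁ x →L[ℝ] E₂ x) : K.{u} X :=
  if h : ∃ ξ, IsIndex F₁ F₂ B ξ then h.choose else 0

end Index

end KTheory

open Topology

set_option linter.unusedSectionVars false

/-! Auxiliary data `(W, π)` for `B` also serve for `[B C]`, so both indices can be computed with the
same `W`. After interchanging the summands `V` and `W`, the kernel of `[B C π]` is that of `[T C]`
with `T = [B π]` fibrewise surjective. By `IsFredholmBundleMap.exists_lift`, `C = T R` for a
continuous family `R`, and the shear `(a, v) ↦ (a + R v, v)` identifies `ker [T C]` with `ker T ⊕ V`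
(`IsFredholmBundleMap.kerFamily_row_iso`). Subtracting `[W]` gives the formula. The same splitting,
applied to two choices of data at once, shows that the index does not depend on the choice
(`AuxData.index_eq`).

Two facts support this. Near a point where `T` is surjective, finitely many linear forms `P` make
`(T, P)` invertible, because invertibility is open in the operator norm
(`exists_continuousOn_inverse_prod`); this yields local triviality of kernels, local lifts, and
openness of surjectivity. Compactness of `X` and cut-off functions then produce the global lift `R`
and the auxiliary data. -/

namespace KTheory

/-! ### Continuity of fibrewise operations on total spaces. -/

section BundleContinuity

variable {X : Type*} [TopologicalSpace X] {F : Type*} [NormedAddCommGroup F] [NormedSpace ℝ F]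
  {E : X → Type*} [∀ x, AddCommGroup (E x)] [∀ x, Module ℝ (E x)] [∀ x, TopologicalSpace (E x)]
  [TopologicalSpace (TotalSpace F E)] [FiberBundle F E] [VectorBundle ℝ F E]
  {Y : Type*} [TopologicalSpace Y] {b : Y → X}

theorem eventually_mem_baseSet {f : ∀ y, E (b y)} {y₀ : Y}
    (hf : ContinuousAt (fun y => TotalSpace.mk' F (b y) (f y)) y₀) :
    ∀ᶠ y in 𝓝 y₀, b y ∈ (trivializationAt F E (b y₀)).baseSet :=
  ((FiberBundle.continuousAt_totalSpace F _).1 hf).1.eventually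
    ((trivializationAt F E (b y₀)).open_baseSet.mem_nhds
      (FiberBundle.mem_baseSet_trivializationAt' (b y₀)))

theorem continuousAt_bundle_add {f g : ∀ y, E (b y)} {y₀ : Y}
    (hf : ContinuousAt (fun y => TotalSpace.mk' F (b y) (f y)) y₀)
    (hg : ContinuousAt (fun y => TotalSpace.mk' F (b y) (g y)) y₀) :
    ContinuousAt (fun y => TotalSpace.mk' F (b y) (f y + g y)) y₀ := by
  have h := eventually_mem_baseSet hf
  rw [FiberBundle.continuousAt_totalSpace] at hf hg ⊢
  refine ⟨hf.1, (hf.2.add hg.2).congr ?_⟩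
  filter_upwards [h] with y hy
  exact (((trivializationAt F E (b y₀)).linear ℝ hy).map_add (f y) (g y)).symm

theorem continuousAt_bundle_smul {r : Y → ℝ} {f : ∀ y, E (b y)} {y₀ : Y}
    (hr : ContinuousAt r y₀) (hf : ContinuousAt (fun y => TotalSpace.mk' F (b y) (f y)) y₀) :
    ContinuousAt (fun y => TotalSpace.mk' F (b y) (r y • f y)) y₀ := by
  have h := eventually_mem_baseSet hf
  rw [FiberBundle.continuousAt_totalSpace] at hf ⊢
  refine ⟨hf.1, (hr.smul hf.2).congr ?_⟩
  filter_upwards [h] with y hy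
  exact (((trivializationAt F E (b y₀)).linear ℝ hy).map_smul (r y) (f y)).symm

theorem continuous_bundle_add {f g : ∀ y, E (b y)}
    (hf : Continuous fun y => TotalSpace.mk' F (b y) (f y))
    (hg : Continuous fun y => TotalSpace.mk' F (b y) (g y)) :
    Continuous fun y => TotalSpace.mk' F (b y) (f y + g y) :=
  continuous_iff_continuousAt.2 fun _ =>
    continuousAt_bundle_add hf.continuousAt hg.continuousAt

theorem continuous_bundle_smul {r : Y → ℝ} {f : ∀ y, E (b y)}
    (hr : Continuous r) (hf : Continuous fun y => TotalSpace.mk' F (b y) (f y)) :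
    Continuous fun y => TotalSpace.mk' F (b y) (r y • f y) :=
  continuous_iff_continuousAt.2 fun _ =>
    continuousAt_bundle_smul hr.continuousAt hf.continuousAt

theorem continuous_bundle_zero (hb : Continuous b) :
    Continuous fun y => TotalSpace.mk' F (b y) (0 : E (b y)) :=
  (Bundle.Trivialization.continuous_zeroSection (F := F) (E := E) ℝ).comp hb

/-- Extension by zero: a family of vectors that is continuous over an open set `U` becomes
continuous after multiplication by a function supported in `U`. -/
theorem continuous_bundle_smul_of_tsupport_subset {r : X → ℝ} {f : ∀ y, E (b y)} {U : Set X}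
    (hr : Continuous r) (hb : Continuous b) (hU : IsOpen U) (hrU : tsupport r ⊆ U)
    (hf : ContinuousOn (fun y => TotalSpace.mk' F (b y) (f y)) (b ⁻¹' U)) :
    Continuous fun y => TotalSpace.mk' F (b y) (r (b y) • f y) := by
  refine continuous_iff_continuousAt.2 fun y₀ => ?_
  by_cases h : b y₀ ∈ U
  · exact continuousAt_bundle_smul (hr.comp hb).continuousAt
      (hf.continuousAt ((hU.preimage hb).mem_nhds h))
  · have h0 : b ⁻¹' (tsupport r)ᶜ ∈ 𝓝 y₀ :=
      ((isClosed_tsupport r).isOpen_compl.preimage hb).mem_nhds fun h' => h (hrU h')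
    refine (continuous_bundle_zero (F := F) (E := E) hb).continuousAt.congr ?_
    filter_upwards [h0] with y hy
    rw [image_eq_zero_of_notMem_tsupport hy, zero_smul]

variable (F) in
theorem continuousOn_mk_symmL (e : Trivialization F (π F E)) [MemTrivializationAtlas e]
    {s : Set Y} {w : Y → F} (hb : ContinuousOn b s) (hw : ContinuousOn w s)
    (hs : ∀ y ∈ s, b y ∈ e.baseSet) :
    ContinuousOn (fun y => TotalSpace.mk' F (b y) (e.symmL ℝ (b y) (w y))) s := by
  have h : ContinuousOn (fun y => TotalSpace.mk' F (b y) (e.symm (b y) (w y))) s :=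
    e.continuousOn_symm.comp (hb.prodMk hw) fun y hy => ⟨hs y hy, Set.mem_univ _⟩
  refine h.congr fun y hy => ?_
  dsimp only
  rw [e.symmL_apply (hs y hy)]

variable (F) in
theorem continuousOn_continuousLinearMapAt (e : Trivialization F (π F E))
    [MemTrivializationAtlas e] {s : Set Y} {f : ∀ y, E (b y)}
    (hf : ContinuousOn (fun y => TotalSpace.mk' F (b y) (f y)) s)
    (hs : ∀ y ∈ s, b y ∈ e.baseSet) :
    ContinuousOn (fun y => e.continuousLinearMapAt ℝ (b y) (f y)) s := by
  have h : ContinuousOn (fun y => (e (TotalSpace.mk' F (b y) (f y))).2) s :=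
    continuous_snd.comp_continuousOn
      (e.continuousOn.comp hf fun y hy => e.mem_source.2 (hs y hy))
  exact h.congr fun y hy => e.continuousLinearMapAt_apply_of_mem ℝ (hs y hy) (f y)

/-- Reduces continuity into `E ⊕ (X × V)` to its two components; the base point of the trivial
factor is already controlled by the first one. -/
theorem continuous_prod_trivial_iff {V : Type} [NormedAddCommGroup V]
    {f : Y → TotalSpace (F × V) (E ×ᵇ Bundle.Trivial X V)} :
    Continuous f ↔ Continuous (fun y => TotalSpace.mk' F (f y).proj (f y).snd.1) ∧
      Continuous (fun y => ((f y).snd.2 : V)) := by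
  rw [(FiberBundle.Prod.isInducing_diag F E V (Bundle.Trivial X V)).continuous_iff]
  refine continuous_prodMk.trans
    ⟨fun h => ⟨h.1, ?_⟩, fun h => ⟨h.1, ?_⟩⟩
  · exact continuous_snd.comp ((Bundle.Trivial.isInducing_toProd X V).continuous_iff.1 h.2)
  · exact (Bundle.Trivial.isInducing_toProd X V).continuous_iff.2
      (((FiberBundle.continuous_proj F E).comp h.1).prodMk h.2)

end BundleContinuity

/-- The main theorem assumes compatible topologies only on the fibres of `E₂`. For `E₁` they follow
because each fibre is linearly homeomorphic to the model space. -/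
theorem isTopologicalAddGroup_fiber {X : Type*} [TopologicalSpace X] (F : Type*) [NormedAddCommGroup F]
    [NormedSpace ℝ F] (E : X → Type*) [∀ x, AddCommGroup (E x)] [∀ x, Module ℝ (E x)]
    [∀ x, TopologicalSpace (E x)] [TopologicalSpace (TotalSpace F E)] [FiberBundle F E]
    [VectorBundle ℝ F E] (x : X) :
    IsTopologicalAddGroup (E x) :=
  have e := VectorBundle.continuousLinearEquivAt ℝ F E x
  e.toHomeomorph.isInducing.topologicalAddGroup e.toLinearMap

theorem continuousSMul_fiber {X : Type*} [TopologicalSpace X] (F : Type*) [NormedAddCommGroup F]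
    [NormedSpace ℝ F] (E : X → Type*) [∀ x, AddCommGroup (E x)] [∀ x, Module ℝ (E x)]
    [∀ x, TopologicalSpace (E x)] [TopologicalSpace (TotalSpace F E)] [FiberBundle F E]
    [VectorBundle ℝ F E] (x : X) :
    ContinuousSMul ℝ (E x) :=
  have e := VectorBundle.continuousLinearEquivAt ℝ F E x
  e.toHomeomorph.isInducing.continuousSMul continuous_id fun {c y} => e.map_smul c y

/-! ### Fredholm operators and families of operators between fixed spaces. -/

section Banach

open ContinuousLinearMap LinearMap.FiniteRangeSetoid

/-- Adding a finite-dimensional summand to the source preserves the Fredholm property. -/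
theorem isFredholm_coprod {E V G : Type*} [AddCommGroup E] [Module ℝ E] [TopologicalSpace E]
    [IsTopologicalAddGroup E] [ContinuousSMul ℝ E] [T2Space E] [NormedAddCommGroup V]
    [NormedSpace ℝ V] [FiniteDimensional ℝ V] [AddCommGroup G] [Module ℝ G] [TopologicalSpace G]
    [IsTopologicalAddGroup G] [ContinuousSMul ℝ G] [T2Space G] {B : E →L[ℝ] G}
    (hB : B.IsFredholm) (C : V →L[ℝ] G) : (B.coprod C).IsFredholm := by
  obtain ⟨v, hv⟩ := hB.exists_isQuasiInverse
  -- The quasi-inverse `(v, 0)` leaves the composite on the right equal to `B v`. On the left, the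
  -- new defect is the old one plus an operator factoring through the finite-dimensional `V`.
  refine IsFredholm.of_isQuasiInverse (v := (ContinuousLinearMap.inl ℝ E V).comp v) ⟨?_, ?_⟩
  · have h₁ := hv.1
    unfold LinearMap.IsLeftQuasiInverse at h₁ ⊢
    rw [LinearMap.FiniteRangeSetoid.equiv_iff_hasFiniteRange] at h₁ ⊢
    have h₃ : (LinearMap.inl ℝ E V ∘ₗ ((v : G →ₗ[ℝ] E) ∘ₗ (B : E →ₗ[ℝ] G) - LinearMap.id) ∘ₗ
        LinearMap.fst ℝ E V).HasFiniteRange := (h₁.comp_right _).comp_left _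
    have h₄ : ((LinearMap.inl ℝ E V ∘ₗ (v : G →ₗ[ℝ] E) ∘ₗ (C : V →ₗ[ℝ] G) -
        LinearMap.inr ℝ E V) ∘ₗ LinearMap.snd ℝ E V).HasFiniteRange :=
      LinearMap.HasFiniteRange.of_finite_dom.comp_right _
    have h₅ : ((ContinuousLinearMap.inl ℝ E V).comp v : G →ₗ[ℝ] E × V) ∘ₗ
        (B.coprod C : E × V →ₗ[ℝ] G) - LinearMap.id =
        LinearMap.inl ℝ E V ∘ₗ ((v : G →ₗ[ℝ] E) ∘ₗ (B : E →ₗ[ℝ] G) - LinearMap.id) ∘ₗ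
          LinearMap.fst ℝ E V + (LinearMap.inl ℝ E V ∘ₗ (v : G →ₗ[ℝ] E) ∘ₗ (C : V →ₗ[ℝ] G) -
          LinearMap.inr ℝ E V) ∘ₗ LinearMap.snd ℝ E V := by
      ext x <;> simp
    rw [h₅]
    exact h₃.add h₄
  · have h₂ := hv.2
    unfold LinearMap.IsRightQuasiInverse at h₂ ⊢
    convert h₂ using 1
    ext x
    simp

/-- A continuous family of surjective Banach space operators with finite-dimensional kernels can be
completed, near a point, to a continuous family of isomorphisms. -/
theorem exists_continuousOn_inverse_prod {X F G : Type*} [TopologicalSpace X]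
    [NormedAddCommGroup F] [NormedSpace ℝ F] [CompleteSpace F] [NormedAddCommGroup G]
    [NormedSpace ℝ G] [CompleteSpace G] {t : X → F →L[ℝ] G} {U₀ : Set X} (hU₀ : IsOpen U₀)
    (ht : ContinuousOn t U₀) {x₀ : X} (hx₀ : x₀ ∈ U₀) (hsurj : Function.Surjective (t x₀))
    (hker : FiniteDimensional ℝ (LinearMap.ker (t x₀ : F →ₗ[ℝ] G))) :
    ∃ U ⊆ U₀, IsOpen U ∧ x₀ ∈ U ∧ ∃ (n : ℕ) (P : F →L[ℝ] EuclideanSpace ℝ (Fin n))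
      (S : X → G × EuclideanSpace ℝ (Fin n) →L[ℝ] F), ContinuousOn S U ∧
      ∀ x ∈ U, (∀ a, S x (t x a, P a) = a) ∧ ∀ q, t x (S x q) = q.1 ∧ P (S x q) = q.2 := by
  set N := LinearMap.ker (t x₀ : F →ₗ[ℝ] G)
  obtain ⟨p, hp⟩ := Submodule.ClosedComplemented.of_finiteDimensional N
  let i : N ≃L[ℝ] EuclideanSpace ℝ (Fin (Module.finrank ℝ N)) :=
    ContinuousLinearEquiv.ofFinrankEq (by simp)
  -- `P` reads off, in coordinates, a continuous projection onto `N = ker (t x₀)`, so `(t x₀, P)` is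
  -- bijective: `t x₀` is injective on `ker p`, and `P` sees exactly the rest.
  let P : F →L[ℝ] EuclideanSpace ℝ (Fin (Module.finrank ℝ N)) := (i : N →L[ℝ] _).comp p
  let s : X → F →L[ℝ] G × EuclideanSpace ℝ (Fin (Module.finrank ℝ N)) := fun x => (t x).prod P
  have hs : ContinuousOn s U₀ := 
    (ContinuousLinearMap.prodₗᵢ ℝ).continuous.comp_continuousOn (ht.prodMk continuousOn_const)
  have hinj : (s x₀).ker = ⊥ := by
    refine LinearMap.ker_eq_bot'.2 fun a ha => ?_
    have h1 : t x₀ a = 0 := congrArg Prod.fst ha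
    have h2 : i (p a) = 0 := congrArg Prod.snd ha
    have h3 := hp ⟨a, h1⟩
    rw [i.map_eq_zero_iff.1 h2] at h3
    exact (congrArg Subtype.val h3).symm
  have hran : (s x₀).range = ⊤ := by
    refine LinearMap.range_eq_top.2 fun q => ?_
    obtain ⟨a, ha⟩ := hsurj q.1
    -- Replacing the `N`-component of a preimage by the prescribed one does not change its image
    -- under `t x₀`.
    refine ⟨a - p a + (i.symm q.2 : N), Prod.ext ?_ ?_⟩
    · have h1 : t x₀ (p a) = 0 := (p a).2
      have h2 : t x₀ (i.symm q.2 : N) = 0 := (i.symm q.2).2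
      change t x₀ (a - p a + (i.symm q.2 : N)) = q.1
      rw [map_add, map_sub, h1, h2, ha, sub_zero, add_zero]
    · change i (p (a - p a + (i.symm q.2 : N))) = q.2
      rw [map_add, map_sub, hp, hp, sub_self, zero_add, i.apply_symm_apply]
  let e := ContinuousLinearEquiv.ofBijective (s x₀) hinj hran
  have hopen : IsOpen (U₀ ∩ s ⁻¹' Set.range ((↑) :
      (F ≃L[ℝ] G × EuclideanSpace ℝ (Fin (Module.finrank ℝ N))) → F →L[ℝ] _)) :=
    hs.isOpen_inter_preimage hU₀ ContinuousLinearEquiv.isOpen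
  refine ⟨_, Set.inter_subset_left, hopen, ⟨hx₀, e, ?_⟩, Module.finrank ℝ N, P,
    fun x => ContinuousLinearMap.inverse (s x), ?_, ?_⟩
  · exact ContinuousLinearEquiv.coe_ofBijective _ _ _
  · rintro x ⟨hx, f, hf⟩
    -- Inversion of operators is norm continuous at every isomorphism; the default value of
    -- `inverse` elsewhere plays no role on this set.
    have h := (contDiffAt_map_inverse (n := 0) f).continuousAt
    rw [hf] at h
    exact (h.comp_continuousWithinAt (hs x hx)).mono Set.inter_subset_left
  · rintro x ⟨hx, f, hf⟩
    dsimp only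
    rw [← hf, ContinuousLinearMap.inverse_equiv]
    have key : ∀ a, f a = (t x a, P a) := fun a => congrArg (fun g => g a) hf
    refine ⟨fun a => by rw [← key]; exact f.symm_apply_apply a, fun q => ?_⟩
    have := f.apply_symm_apply q
    rw [key] at this
    exact ⟨congrArg Prod.fst this, congrArg Prod.snd this⟩

end Banach

/-! ### Local structure of Fredholm bundle maps. -/

section FredholmBundleMap

variable {X : Type v} [TopologicalSpace X]
  {F₁ : Type*} [NormedAddCommGroup F₁] [NormedSpace ℝ F₁]
  {E₁ : X → Type u} [∀ x, AddCommGroup (E₁ x)] [∀ x, Module ℝ (E₁ x)]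
  [∀ x, TopologicalSpace (E₁ x)] [TopologicalSpace (TotalSpace F₁ E₁)]
  [FiberBundle F₁ E₁] [VectorBundle ℝ F₁ E₁]
  {F₂ : Type*} [NormedAddCommGroup F₂] [NormedSpace ℝ F₂]
  {E₂ : X → Type*} [∀ x, AddCommGroup (E₂ x)] [∀ x, Module ℝ (E₂ x)]
  [∀ x, TopologicalSpace (E₂ x)] [TopologicalSpace (TotalSpace F₂ E₂)]
  [FiberBundle F₂ E₂] [VectorBundle ℝ F₂ E₂]
  [∀ x, IsTopologicalAddGroup (E₂ x)] [∀ x, ContinuousSMul ℝ (E₂ x)]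
  {V W : Type} [NormedAddCommGroup V] [NormedSpace ℝ V] [FiniteDimensional ℝ V]
  [NormedAddCommGroup W] [NormedSpace ℝ W] [FiniteDimensional ℝ W]
  {T : ∀ x, E₁ x →L[ℝ] E₂ x}

theorem IsLinearBundleMap.apply {C : ∀ x, V →L[ℝ] E₂ x} (hC : IsLinearBundleMap F₂ C)
    {Y : Type*} [TopologicalSpace Y] {b : Y → X} {w : Y → V} (hb : Continuous b)
    (hw : Continuous w) : Continuous fun y => TotalSpace.mk' F₂ (b y) (C (b y) (w y)) :=
  hC.comp (hb.prodMk hw)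

/-- A linear bundle map from a trivial bundle of finite rank is norm continuous in local
trivializations. -/
theorem IsLinearBundleMap.continuousOn_clm {C : ∀ x, V →L[ℝ] E₂ x}
    (hC : IsLinearBundleMap F₂ C) (e : Trivialization F₂ (π F₂ E₂)) [MemTrivializationAtlas e] :
    ContinuousOn (fun x => (e.continuousLinearMapAt ℝ x).comp (C x)) e.baseSet :=
  continuousOn_clm_apply.2 fun v => continuousOn_continuousLinearMapAt F₂ e (b := id)
    (hC.apply continuous_id (continuous_const (y := v))).continuousOn fun _ hx => hx

theorem symmL_prod_trivial {x₀ x : X} (hx : x ∈ (trivializationAt F₁ E₁ x₀).baseSet)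
    (q : F₁ × V) :
    (trivializationAt (F₁ × V) (E₁ ×ᵇ Bundle.Trivial X V) x₀).symmL ℝ x q =
      ((trivializationAt F₁ E₁ x₀).symmL ℝ x q.1, q.2) := by
  set e := trivializationAt (F₁ × V) (E₁ ×ᵇ Bundle.Trivial X V) x₀
  have hx' : x ∈ e.baseSet := ⟨hx, Set.mem_univ _⟩
  -- The forward trivialization is a product by construction, so the inverse is identified by
  -- applying the forward map to the claimed value.
  rw [← e.symmL_continuousLinearMapAt (R := ℝ) hx' ((trivializationAt F₁ E₁ x₀).symmL ℝ x q.1, q.2),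
    e.continuousLinearMapAt_apply_of_mem ℝ hx']
  congr 1
  exact Prod.ext
    (((trivializationAt F₁ E₁ x₀).continuousLinearMapAt_symmL (R := ℝ) hx q.1).symm.trans
      ((trivializationAt F₁ E₁ x₀).continuousLinearMapAt_apply_of_mem ℝ hx _)) rfl

/-- In trivializations at `x₀` the map is `t ∘ fst + c ∘ snd`. Here `c` is norm continuous, not
merely pointwise continuous, because `V` is finite-dimensional. -/
theorem isFredholmBundleMap_row (hT : IsFredholmBundleMap F₁ F₂ T) {C : ∀ x, V →L[ℝ] E₂ x}
    (hC : IsLinearBundleMap F₂ C) : IsFredholmBundleMap (F₁ × V) F₂ (row T C) := by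
  refine ⟨continuous_iff_continuousAt.2 fun x₀ => ?_, fun x => ?_⟩
  · rw [continuousAt_hom_bundle]
    refine ⟨continuousAt_id, ?_⟩
    have h₁ := ((continuousAt_hom_bundle (RingHom.id ℝ) _).1 (hT.continuous.continuousAt (x := x₀))).2
    have hm₁ := FiberBundle.mem_baseSet_trivializationAt' (F := F₁) (E := E₁) x₀
    have hm₂ := FiberBundle.mem_baseSet_trivializationAt' (F := F₂) (E := E₂) x₀
    have h₂ := (hC.continuousOn_clm (trivializationAt F₂ E₂ x₀)).continuousAt
      ((trivializationAt F₂ E₂ x₀).open_baseSet.mem_nhds hm₂)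
    have h₃ := (h₁.clm_comp (continuousAt_const (y := ContinuousLinearMap.fst ℝ F₁ V))).add
      (h₂.clm_comp (continuousAt_const (y := ContinuousLinearMap.snd ℝ F₁ V)))
    refine h₃.congr ?_
    filter_upwards [(trivializationAt F₁ E₁ x₀).open_baseSet.mem_nhds hm₁] with x hx
    refine ContinuousLinearMap.ext fun q => ?_
    change (trivializationAt F₂ E₂ x₀).continuousLinearMapAt ℝ x
        (T x ((trivializationAt F₁ E₁ x₀).symmL ℝ x q.1)) +
        (trivializationAt F₂ E₂ x₀).continuousLinearMapAt ℝ x (C x q.2) =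
      (trivializationAt F₂ E₂ x₀).continuousLinearMapAt ℝ x (row T C x
        ((trivializationAt (F₁ × V) (E₁ ×ᵇ Bundle.Trivial X V) x₀).symmL ℝ x q))
    rw [symmL_prod_trivial hx, ← map_add]
    rfl
  · have := isTopologicalAddGroup_fiber F₁ E₁ x
    have := continuousSMul_fiber F₁ E₁ x
    have := FiberBundle.t2Space F₁ E₁ x
    have := FiberBundle.t2Space F₂ E₂ x
    exact isFredholm_coprod (hT.isFredholm x) (C x)

/-- Near a point where a Fredholm bundle map is surjective, it is completed to an isomorphism by
finitely many linear forms. -/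
theorem IsFredholmBundleMap.exists_local_inverse [CompleteSpace F₁] [CompleteSpace F₂]
    (hT : IsFredholmBundleMap F₁ F₂ T) {x₀ : X} (hx₀ : Function.Surjective (T x₀)) :
    ∃ U ⊆ (trivializationAt F₁ E₁ x₀).baseSet ∩ (trivializationAt F₂ E₂ x₀).baseSet,
      IsOpen U ∧ x₀ ∈ U ∧ ∃ (n : ℕ) (P : F₁ →L[ℝ] EuclideanSpace ℝ (Fin n))
      (S : X → F₂ × EuclideanSpace ℝ (Fin n) →L[ℝ] F₁), ContinuousOn S U ∧
      ∀ x ∈ U,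
        (∀ a, (trivializationAt F₁ E₁ x₀).symmL ℝ x (S x
          ((trivializationAt F₂ E₂ x₀).continuousLinearMapAt ℝ x (T x a),
            P ((trivializationAt F₁ E₁ x₀).continuousLinearMapAt ℝ x a))) = a) ∧
        ∀ q : F₂ × EuclideanSpace ℝ (Fin n),
          T x ((trivializationAt F₁ E₁ x₀).symmL ℝ x (S x q)) =
            (trivializationAt F₂ E₂ x₀).symmL ℝ x q.1 ∧
          P ((trivializationAt F₁ E₁ x₀).continuousLinearMapAt ℝ x
            ((trivializationAt F₁ E₁ x₀).symmL ℝ x (S x q))) = q.2 := by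
  set e₁ := trivializationAt F₁ E₁ x₀
  set e₂ := trivializationAt F₂ E₂ x₀
  let t : X → F₁ →L[ℝ] F₂ := fun x =>
    (e₂.continuousLinearMapAt ℝ x).comp ((T x).comp (e₁.symmL ℝ x))
  have hm : x₀ ∈ e₁.baseSet ∩ e₂.baseSet := ⟨FiberBundle.mem_baseSet_trivializationAt' x₀,
    FiberBundle.mem_baseSet_trivializationAt' x₀⟩
  have ht : ContinuousOn t (e₁.baseSet ∩ e₂.baseSet) := by
    have h := (trivializationAt (F₁ →L[ℝ] F₂) (fun x => E₁ x →L[ℝ] E₂ x) x₀).continuousOn.comp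
      hT.continuous.continuousOn (s := e₁.baseSet ∩ e₂.baseSet) fun x hx => hx
    exact continuous_snd.comp_continuousOn h
  have hs : Function.Surjective (t x₀) := by
    intro z
    obtain ⟨a, ha⟩ := hx₀ (e₂.symmL ℝ x₀ z)
    refine ⟨e₁.continuousLinearMapAt ℝ x₀ a, ?_⟩
    change e₂.continuousLinearMapAt ℝ x₀ (T x₀ (e₁.symmL ℝ x₀ (e₁.continuousLinearMapAt ℝ x₀ a))) = z
    rw [e₁.symmL_continuousLinearMapAt hm.1, ha, e₂.continuousLinearMapAt_symmL hm.2]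
  have hk : FiniteDimensional ℝ (LinearMap.ker (t x₀ : F₁ →ₗ[ℝ] F₂)) := by
    have := (hT.isFredholm x₀).finite_ker
    have hmem : ∀ a : LinearMap.ker (t x₀ : F₁ →ₗ[ℝ] F₂), e₁.symmL ℝ x₀ a ∈ (T x₀).ker := by
      rintro ⟨a, ha⟩
      have h := congrArg (e₂.symmL ℝ x₀) ha
      change e₂.symmL ℝ x₀ (e₂.continuousLinearMapAt ℝ x₀ (T x₀ (e₁.symmL ℝ x₀ a))) = _ at h
      rwa [e₂.symmL_continuousLinearMapAt hm.2, map_zero] at h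
    refine FiniteDimensional.of_injective (LinearMap.codRestrict (T x₀).ker
      ((e₁.symmL ℝ x₀ : F₁ →ₗ[ℝ] E₁ x₀) ∘ₗ Submodule.subtype _) hmem) fun a b hab => ?_
    have h := congrArg (fun z => e₁.continuousLinearMapAt ℝ x₀ (z : (T x₀).ker)) hab
    change e₁.continuousLinearMapAt ℝ x₀ (e₁.symmL ℝ x₀ a) =
      e₁.continuousLinearMapAt ℝ x₀ (e₁.symmL ℝ x₀ b) at h
    rw [e₁.continuousLinearMapAt_symmL hm.1, e₁.continuousLinearMapAt_symmL hm.1] at h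
    exact Subtype.ext h
  obtain ⟨U, hU, hUo, hxU, n, P, S, hS, hSx⟩ := exists_continuousOn_inverse_prod
    (e₁.open_baseSet.inter e₂.open_baseSet) ht hm hs hk
  refine ⟨U, hU, hUo, hxU, n, P, S, hS, fun x hx => ?_⟩
  obtain ⟨hx₁, hx₂⟩ := hU hx
  obtain ⟨h₁, h₂⟩ := hSx x hx
  refine ⟨fun a => ?_, fun q => ⟨?_, ?_⟩⟩
  · have h := h₁ (e₁.continuousLinearMapAt ℝ x a)
    change S x (e₂.continuousLinearMapAt ℝ x (T x (e₁.symmL ℝ x (e₁.continuousLinearMapAt ℝ x a))), _)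
      = _ at h
    rw [e₁.symmL_continuousLinearMapAt hx₁] at h
    rw [h, e₁.symmL_continuousLinearMapAt hx₁]
  · rw [← (h₂ q).1]
    exact (e₂.symmL_continuousLinearMapAt hx₂ _).symm
  · rw [e₁.continuousLinearMapAt_symmL hx₁, (h₂ q).2]

/-- The local inverse `S`, with second argument `0`, is a right inverse of `T` at every nearby
point. -/
theorem IsFredholmBundleMap.eventually_surjective [CompleteSpace F₁] [CompleteSpace F₂]
    (hT : IsFredholmBundleMap F₁ F₂ T) {x₀ : X} (hx₀ : Function.Surjective (T x₀)) :
    ∀ᶠ x in 𝓝 x₀, Function.Surjective (T x) := by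
  obtain ⟨U, hU, hUo, hxU, n, P, S, -, hS⟩ := hT.exists_local_inverse hx₀
  filter_upwards [hUo.mem_nhds hxU] with x hx z
  exact ⟨_, (((hS x hx).2 (_, 0)).1).trans
    ((trivializationAt F₂ E₂ x₀).symmL_continuousLinearMapAt (hU hx).2 z)⟩

variable (F₁ T) in
/-- The fibrewise inclusion of the family of kernels. -/
def kerFamilyIncl (x : X) : (kerFamily F₁ T).Fib x →ₗ[ℝ] E₁ x :=
  Submodule.subtype (LinearMap.ker (T x : E₁ x →ₗ[ℝ] E₂ x))

theorem continuous_kerFamily_iff {Y : Type*} [TopologicalSpace Y]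
    {f : Y → (kerFamily F₁ T).Total} : Continuous f ↔
      Continuous fun y => TotalSpace.mk' F₁ (f y).proj (kerFamilyIncl F₁ T _ (f y).snd) :=
  continuous_induced_rng

/-- The local isomorphism `(T, P)` carries `ker T` onto `0 × ℝⁿ`. Hence `P` trivializes the kernels,
with inverse `S (0, ·)`. -/
theorem isLocallyTrivial_kerFamily [CompleteSpace F₁] [CompleteSpace F₂]
    (hT : IsFredholmBundleMap F₁ F₂ T) (hs : ∀ x, Function.Surjective (T x)) :
    (kerFamily F₁ T).IsLocallyTrivial := by
  intro x₀
  obtain ⟨U, hU, hUo, hxU, n, P, S, hSc, hS⟩ := hT.exists_local_inverse (hs x₀)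
  set e₁ := trivializationAt F₁ E₁ x₀
  set e₂ := trivializationAt F₂ E₂ x₀
  refine ⟨U, hUo, hxU, EuclideanSpace ℝ (Fin n), inferInstance, inferInstance, inferInstance,
    fun x => LinearEquiv.ofLinearMap
      ((P : F₁ →ₗ[ℝ] EuclideanSpace ℝ (Fin n)) ∘ₗ (e₁.continuousLinearMapAt ℝ x.1 : E₁ x →ₗ[ℝ] F₁) ∘ₗ
        Submodule.subtype _)
      (LinearMap.codRestrict _ ((e₁.symmL ℝ x.1 : F₁ →ₗ[ℝ] E₁ x) ∘ₗ
        (S x : F₂ × EuclideanSpace ℝ (Fin n) →ₗ[ℝ] F₁) ∘ₗ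
        LinearMap.inr ℝ F₂ (EuclideanSpace ℝ (Fin n))) fun w => ?_) ?_ ?_, ?_, ?_⟩
  · exact ((hS x x.2).2 (0, w)).1.trans (map_zero _)
  · ext1 w
    exact ((hS x x.2).2 (0, w)).2
  · ext1 a
    refine Subtype.ext (Eq.trans ?_ ((hS x x.2).1 (kerFamilyIncl F₁ T x a)))
    rw [show T x (kerFamilyIncl F₁ T x a) = 0 from a.2, map_zero]
    rfl
  · refine P.continuous.comp (continuousOn_univ.1 (continuousOn_continuousLinearMapAt F₁ e₁
      (b := fun p : {p : (kerFamily F₁ T).Total // p.proj ∈ U} => p.1.proj)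
      (f := fun p => kerFamilyIncl F₁ T _ p.1.snd)
      (continuous_kerFamily_iff.1 continuous_subtype_val).continuousOn fun p _ => (hU p.2).1))
  · refine continuous_kerFamily_iff.2 (continuousOn_univ.1 (continuousOn_mk_symmL F₁ e₁
      (b := fun q : U × EuclideanSpace ℝ (Fin n) => (q.1 : X))
      (w := fun q => S q.1 (0, q.2))
      (continuous_subtype_val.comp continuous_fst).continuousOn ?_ fun q _ => (hU q.1.2).1))
    exact ((hSc.comp_continuous (continuous_subtype_val.comp continuous_fst) fun q => q.1.2).clm_apply
      (continuous_const.prodMk continuous_snd)).continuousOn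

end FredholmBundleMap

/-! ### Global lifts and auxiliary data from compactness. -/

section Gluing

variable {X : Type v} [TopologicalSpace X]
  {F₁ : Type*} [NormedAddCommGroup F₁] [NormedSpace ℝ F₁]
  {E₁ : X → Type u} [∀ x, AddCommGroup (E₁ x)] [∀ x, Module ℝ (E₁ x)]
  [∀ x, TopologicalSpace (E₁ x)] [TopologicalSpace (TotalSpace F₁ E₁)]
  [FiberBundle F₁ E₁] [VectorBundle ℝ F₁ E₁]
  {F₂ : Type*} [NormedAddCommGroup F₂] [NormedSpace ℝ F₂]
  {E₂ : X → Type*} [∀ x, AddCommGroup (E₂ x)] [∀ x, Module ℝ (E₂ x)]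
  [∀ x, TopologicalSpace (E₂ x)] [TopologicalSpace (TotalSpace F₂ E₂)]
  [FiberBundle F₂ E₂] [VectorBundle ℝ F₂ E₂]
  [∀ x, IsTopologicalAddGroup (E₂ x)] [∀ x, ContinuousSMul ℝ (E₂ x)]
  {V W : Type} [NormedAddCommGroup V] [NormedSpace ℝ V] [FiniteDimensional ℝ V]
  [NormedAddCommGroup W] [NormedSpace ℝ W] [FiniteDimensional ℝ W]
  {T : ∀ x, E₁ x →L[ℝ] E₂ x}

theorem exists_bump [CompactSpace X] [T2Space X] {U : Set X} (hU : IsOpen U) {x₀ : X}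
    (hx₀ : x₀ ∈ U) : ∃ r : X → ℝ, Continuous r ∧ r x₀ = 1 ∧ tsupport r ⊆ U ∧ ∀ x, 0 ≤ r x := by
  obtain ⟨f, h₁, -, h₃, h₄⟩ := exists_continuousMap_one_of_isCompact_subset_isOpen
    (isCompact_singleton (x := x₀)) hU (Set.singleton_subset_iff.2 hx₀)
  exact ⟨f, f.continuous, h₁ rfl, h₃, fun x => (h₄ x).1⟩

/-- A linear bundle map defined over an open set, cut off by a function supported there. -/
theorem isLinearBundleMap_smul {r : X → ℝ} (hr : Continuous r) {U : Set X} (hU : IsOpen U)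
    (hrU : tsupport r ⊆ U) {C : ∀ x, V →L[ℝ] E₂ x}
    (hC : ContinuousOn (fun p : X × V => TotalSpace.mk' F₂ p.1 (C p.1 p.2)) (Prod.fst ⁻¹' U)) :
    IsLinearBundleMap F₂ fun x => r x • C x :=
  continuous_bundle_smul_of_tsupport_subset (b := fun p : X × V => p.1)
    (f := fun p => C p.1 p.2) hr continuous_fst hU hrU hC

/-- Over a compact Hausdorff space, linear bundle maps from trivial bundles of finite rank lift
along surjective Fredholm bundle maps. -/
theorem IsFredholmBundleMap.exists_lift [CompactSpace X] [T2Space X] [CompleteSpace F₁]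
    [CompleteSpace F₂] (hT : IsFredholmBundleMap F₁ F₂ T)
    (hs : ∀ x, Function.Surjective (T x)) {C : ∀ x, V →L[ℝ] E₂ x}
    (hC : IsLinearBundleMap F₂ C) :
    ∃ R : ∀ x, V →L[ℝ] E₁ x, IsLinearBundleMap F₁ R ∧ ∀ x v, T x (R x v) = C x v := by
  have i₁ := isTopologicalAddGroup_fiber F₁ E₁
  have i₂ := continuousSMul_fiber F₁ E₁
  -- The equation `T R = C` is relaxed to `T R = φ C` with `φ ≥ 0`, positive on the set in question.
  -- Solutions on two sets add up to one on their union, so compactness applies without a partition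
  -- of unity; dividing by `φ` comes last.
  have key : ∃ (R : ∀ x, V →L[ℝ] E₁ x) (φ : X → ℝ), IsLinearBundleMap F₁ R ∧ Continuous φ ∧
      (∀ x, 0 ≤ φ x) ∧ (∀ x ∈ Set.univ, 0 < φ x) ∧ ∀ x v, T x (R x v) = φ x • C x v := by
    refine isCompact_univ.induction_on (p := fun s => ∃ (R : ∀ x, V →L[ℝ] E₁ x) (φ : X → ℝ),
      IsLinearBundleMap F₁ R ∧ Continuous φ ∧ (∀ x, 0 ≤ φ x) ∧ (∀ x ∈ s, 0 < φ x) ∧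
        ∀ x v, T x (R x v) = φ x • C x v) ?_ ?_ ?_ ?_
    · exact ⟨fun _ => 0, fun _ => 0, continuous_bundle_zero continuous_fst, continuous_const,
        fun _ => le_rfl, fun _ h => h.elim, fun x v => by simp⟩
    · rintro s t hst ⟨R, φ, h₁, h₂, h₃, h₄, h₅⟩
      exact ⟨R, φ, h₁, h₂, h₃, fun x hx => h₄ x (hst hx), h₅⟩
    · rintro s t ⟨R, φ, h₁, h₂, h₃, h₄, h₅⟩ ⟨R', φ', h₁', h₂', h₃', h₄', h₅'⟩
      refine ⟨fun x => R x + R' x, fun x => φ x + φ' x, continuous_bundle_add h₁ h₁', h₂.add h₂',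
        fun x => add_nonneg (h₃ x) (h₃' x), ?_, fun x v => ?_⟩
      · rintro x (hx | hx)
        · exact add_pos_of_pos_of_nonneg (h₄ x hx) (h₃' x)
        · exact add_pos_of_nonneg_of_pos (h₃ x) (h₄' x hx)
      · rw [add_apply, map_add, h₅, h₅', add_smul]
    · intro x₀ _
      obtain ⟨U, hU, hUo, hxU, n, P, S, hSc, hS⟩ := hT.exists_local_inverse (hs x₀)
      obtain ⟨r, hr, hr₁, hrU, hr₀⟩ := exists_bump hUo hxU
      set e₁ := trivializationAt F₁ E₁ x₀
      set e₂ := trivializationAt F₂ E₂ x₀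
      -- `L` is the local lift `S (C, 0)`. It is meaningful only over `U`, and the factor `r`
      -- removes it elsewhere.
      let L : ∀ x, V →L[ℝ] E₁ x := fun x => (e₁.symmL ℝ x).comp ((S x).comp
        ((ContinuousLinearMap.inl ℝ F₂ (EuclideanSpace ℝ (Fin n))).comp
          ((e₂.continuousLinearMapAt ℝ x).comp (C x))))
      have hL : ContinuousOn (fun p : X × V => TotalSpace.mk' F₁ p.1 (L p.1 p.2))
          (Prod.fst ⁻¹' U) := by
        have h := continuousOn_continuousLinearMapAt F₂ e₂ (b := fun p : X × V => p.1)
          (f := fun p => C p.1 p.2) hC.continuousOn (s := Prod.fst ⁻¹' U) fun p hp => (hU hp).2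
        exact continuousOn_mk_symmL F₁ e₁ continuousOn_fst
          ((hSc.comp continuousOn_fst fun p hp => hp).clm_apply (h.prodMk continuousOn_const))
          fun p hp => (hU hp).1
      refine ⟨r ⁻¹' Set.Ioi 0, ?_, fun x => r x • L x, r, isLinearBundleMap_smul hr hUo hrU hL, hr,
        hr₀, fun x hx => hx, fun x v => ?_⟩
      · rw [nhdsWithin_univ]
        exact hr.continuousAt.preimage_mem_nhds
          (isOpen_Ioi.mem_nhds (by rw [hr₁]; exact zero_lt_one' ℝ))
      · rw [smul_apply, map_smul]
        by_cases hx : x ∈ U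
        · rw [show T x (L x v) = C x v from (((hS x hx).2 (_, 0)).1).trans
            (e₂.symmL_continuousLinearMapAt (hU hx).2 _)]
        · rw [image_eq_zero_of_notMem_tsupport fun h => hx (hrU h), zero_smul, zero_smul]
  obtain ⟨R, φ, h₁, h₂, -, h₄, h₅⟩ := key
  have h₀ : ∀ x, φ x ≠ 0 := fun x => (h₄ x trivial).ne'
  refine ⟨fun x => (φ x)⁻¹ • R x, ?_, fun x v => ?_⟩
  · exact continuous_bundle_smul (b := fun p : X × V => p.1) (f := fun p => R p.1 p.2)
      ((h₂.inv₀ h₀).comp continuous_fst) h₁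
  · rw [smul_apply, map_smul, h₅, smul_smul, inv_mul_cancel₀ (h₀ x), one_smul]

/-- The linear bundle map out of `X × (V × W)` given by its two restrictions. -/
theorem IsLinearBundleMap.coprod {C : ∀ x, V →L[ℝ] E₂ x} (hC : IsLinearBundleMap F₂ C)
    {D : ∀ x, W →L[ℝ] E₂ x} (hD : IsLinearBundleMap F₂ D) :
    IsLinearBundleMap F₂ fun x => (C x).coprod (D x) :=
  continuous_bundle_add
    (hC.apply continuous_fst (continuous_fst.comp continuous_snd))
    (hD.apply continuous_fst (continuous_snd.comp continuous_snd))

/-- Auxiliary data exist for a Fredholm bundle map over a compact Hausdorff space. -/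
theorem IsFredholmBundleMap.nonempty_auxData [CompactSpace X] [T2Space X] [CompleteSpace F₁]
    [CompleteSpace F₂] (hT : IsFredholmBundleMap F₁ F₂ T) : Nonempty (AuxData F₂ T) := by
  have key : ∃ (k : ℕ) (C : ∀ x, EuclideanSpace ℝ (Fin k) →L[ℝ] E₂ x), IsLinearBundleMap F₂ C ∧
      ∀ x ∈ Set.univ, Function.Surjective (row T C x) := by
    refine isCompact_univ.induction_on (p := fun s => ∃ (k : ℕ)
      (C : ∀ x, EuclideanSpace ℝ (Fin k) →L[ℝ] E₂ x), IsLinearBundleMap F₂ C ∧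
        ∀ x ∈ s, Function.Surjective (row T C x)) ?_ ?_ ?_ ?_
    · exact ⟨0, fun _ => 0, continuous_bundle_zero continuous_fst, fun _ h => h.elim⟩
    · rintro s t hst ⟨k, C, h₁, h₂⟩
      exact ⟨k, C, h₁, fun x hx => h₂ x (hst hx)⟩
    · rintro s t ⟨k, C, hC, hs⟩ ⟨l, D, hD, ht⟩
      -- Two sets of data are placed side by side; setting one argument to `0` recovers either, so
      -- surjectivity survives on both sets.
      let i : EuclideanSpace ℝ (Fin (k + l)) ≃L[ℝ]
          EuclideanSpace ℝ (Fin k) × EuclideanSpace ℝ (Fin l) :=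
        ContinuousLinearEquiv.ofFinrankEq (by simp)
      refine ⟨k + l, fun x => ((C x).coprod (D x)).comp (i : _ →L[ℝ] _),
        (hC.coprod hD).apply continuous_fst (i.continuous.comp continuous_snd), ?_⟩
      rintro x (hx | hx) z
      · obtain ⟨⟨a, w⟩, h⟩ := hs x hx z
        refine ⟨(a, i.symm (w, 0)), Eq.trans ?_ h⟩
        change T x a + (C x).coprod (D x) (i (i.symm (w, 0))) = T x a + C x w
        rw [i.apply_symm_apply]
        simp
      · obtain ⟨⟨a, w⟩, h⟩ := ht x hx z
        refine ⟨(a, i.symm (0, w)), Eq.trans ?_ h⟩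
        change T x a + (C x).coprod (D x) (i (i.symm (0, w))) = T x a + D x w
        rw [i.apply_symm_apply]
        simp
    · intro x₀ _
      set e₂ := trivializationAt F₂ E₂ x₀
      have hm : x₀ ∈ e₂.baseSet := FiberBundle.mem_baseSet_trivializationAt' x₀
      obtain ⟨r, hr, hr₁, hrU, -⟩ := exists_bump e₂.open_baseSet hm
      -- A complement of the range is finite-dimensional by the Fredholm property. Spread to nearby
      -- fibres by the trivialization and cut off by `r`, it makes `[T C]` surjective at `x₀`, hence
      -- near `x₀`.
      obtain ⟨N, hN⟩ := (T x₀).range.exists_isCompl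
      have hf : FiniteDimensional ℝ N :=
        .of_fg <| (hT.isFredholm x₀).finite_coker.fg_of_isCompl hN
      have := FiberBundle.t2Space F₂ E₂ x₀
      let i : EuclideanSpace ℝ (Fin (Module.finrank ℝ N)) ≃L[ℝ] N :=
        ContinuousLinearEquiv.ofFinrankEq (by simp)
      let σ : EuclideanSpace ℝ (Fin (Module.finrank ℝ N)) →L[ℝ] F₂ :=
        (e₂.continuousLinearMapAt ℝ x₀).comp (N.subtypeL.comp (i : _ →L[ℝ] _))
      let C : ∀ x, EuclideanSpace ℝ (Fin (Module.finrank ℝ N)) →L[ℝ] E₂ x :=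
        fun x => r x • (e₂.symmL ℝ x).comp σ
      have hC : IsLinearBundleMap F₂ C := isLinearBundleMap_smul hr e₂.open_baseSet hrU
        (continuousOn_mk_symmL F₂ e₂ continuousOn_fst
          (σ.continuous.comp continuous_snd).continuousOn fun p hp => hp)
      have hs : Function.Surjective (row T C x₀) := by
        intro z
        obtain ⟨y, hy, w, hw, rfl⟩ := Submodule.mem_sup.1
          (show z ∈ (T x₀).range ⊔ N by rw [hN.sup_eq_top]; trivial)
        obtain ⟨a, rfl⟩ := hy
        refine ⟨(a, i.symm ⟨w, hw⟩), ?_⟩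
        change T x₀ a + r x₀ • e₂.symmL ℝ x₀ (e₂.continuousLinearMapAt ℝ x₀
          (i (i.symm ⟨w, hw⟩) : N)) = T x₀ a + w
        rw [hr₁, one_smul, e₂.symmL_continuousLinearMapAt hm, i.apply_symm_apply]
      have h := (isFredholmBundleMap_row hT hC).eventually_surjective hs
      exact ⟨_, by rw [nhdsWithin_univ]; exact h, _, C, hC, fun x hx => hx⟩
  obtain ⟨k, C, hC, hs⟩ := key
  exact ⟨⟨k, C, hC, fun x => hs x trivial⟩⟩

end Gluing

/-! ### Isomorphisms between kernel bundles. -/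

section KernelBundles

variable {X : Type v} [TopologicalSpace X]
  {F₁ : Type*} [NormedAddCommGroup F₁] [NormedSpace ℝ F₁]
  {E₁ : X → Type u} [∀ x, AddCommGroup (E₁ x)] [∀ x, Module ℝ (E₁ x)]
  [∀ x, TopologicalSpace (E₁ x)] [TopologicalSpace (TotalSpace F₁ E₁)]
  [FiberBundle F₁ E₁] [VectorBundle ℝ F₁ E₁]
  {F₂ : Type*} [NormedAddCommGroup F₂] [NormedSpace ℝ F₂]
  {E₂ : X → Type*} [∀ x, AddCommGroup (E₂ x)] [∀ x, Module ℝ (E₂ x)]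
  [∀ x, TopologicalSpace (E₂ x)] [TopologicalSpace (TotalSpace F₂ E₂)]
  [FiberBundle F₂ E₂] [VectorBundle ℝ F₂ E₂]
  [∀ x, IsTopologicalAddGroup (E₂ x)] [∀ x, ContinuousSMul ℝ (E₂ x)]
  {V W : Type} [NormedAddCommGroup V] [NormedSpace ℝ V] [FiniteDimensional ℝ V]
  [NormedAddCommGroup W] [NormedSpace ℝ W] [FiniteDimensional ℝ W]
  {T : ∀ x, E₁ x →L[ℝ] E₂ x}

/-- The kernel of `[T C]` splits as `ker T ⊕ (X × V)` when `T` is surjective. -/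
theorem IsFredholmBundleMap.kerFamily_row_iso [CompactSpace X] [T2Space X] [CompleteSpace F₁]
    [CompleteSpace F₂] (hT : IsFredholmBundleMap F₁ F₂ T)
    (hs : ∀ x, Function.Surjective (T x)) {C : ∀ x, V →L[ℝ] E₂ x}
    (hC : IsLinearBundleMap F₂ C) :
    (kerFamily (F₁ × V) (row T C)).Iso ((kerFamily F₁ T).sum (Family.trivial X V)) := by
  have i₁ := isTopologicalAddGroup_fiber F₁ E₁
  have i₂ := continuousSMul_fiber F₁ E₁
  obtain ⟨R, hR, hRC⟩ := hT.exists_lift hs hC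
  let ι : ∀ x, (kerFamily (F₁ × V) (row T C)).Fib x →ₗ[ℝ] E₁ x × V :=
    kerFamilyIncl (F₁ × V) (row T C)
  have hι : ∀ x a, T x (ι x a).1 + C x (ι x a).2 = 0 := fun x a => a.2
  -- `a + R v` lies in `ker T` because `T (a + R v) = T a + C v = 0`. The inverse `g` sends `(a, v)`
  -- to `(a - R v, v)`.
  let f : ∀ x, (kerFamily (F₁ × V) (row T C)).Fib x →ₗ[ℝ] (kerFamily F₁ T).Fib x :=
    fun x => LinearMap.codRestrict _ (((LinearMap.id : E₁ x →ₗ[ℝ] E₁ x).coprod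
      (R x : V →ₗ[ℝ] E₁ x)) ∘ₗ ι x) fun a =>
        (map_add (T x) (ι x a).1 (R x (ι x a).2)).trans ((congrArg _ (hRC x _)).trans (hι x a))
  let g : ∀ x, (kerFamily F₁ T).Fib x × ULift.{u} V →ₗ[ℝ] (kerFamily (F₁ × V) (row T C)).Fib x :=
    fun x => LinearMap.codRestrict _ (((kerFamilyIncl F₁ T x).coprod
      (-((R x : V →ₗ[ℝ] E₁ x) ∘ₗ (ULift.moduleEquiv : ULift V ≃ₗ[ℝ] V).toLinearMap))).prod
        ((ULift.moduleEquiv : ULift V ≃ₗ[ℝ] V).toLinearMap ∘ₗ LinearMap.snd ℝ _ _)) fun q => by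
      change T x (kerFamilyIncl F₁ T x q.1 + -R x q.2.down) + C x q.2.down = 0
      rw [map_add, map_neg, hRC, show T x (kerFamilyIncl F₁ T x q.1) = 0 from q.1.2]
      simp
  refine ⟨fun x => LinearEquiv.ofLinearMap
    ((f x).prod ((ULift.moduleEquiv : ULift.{u} V ≃ₗ[ℝ] V).symm.toLinearMap ∘ₗ
      LinearMap.snd ℝ _ _ ∘ₗ ι x)) (g x) ?_ ?_, ?_, ?_⟩
  · refine LinearMap.ext fun q => Prod.ext (Subtype.ext ?_) rfl
    change (kerFamilyIncl F₁ T x q.1 + -R x q.2.down) + R x q.2.down = kerFamilyIncl F₁ T x q.1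
    rw [neg_add_cancel_right]
  · refine LinearMap.ext fun a => Subtype.ext (Prod.ext ?_ rfl)
    change ((ι x a).1 + R x (ι x a).2) + -R x (ι x a).2 = (ι x a).1
    rw [add_neg_cancel_right]
  · have h := continuous_prod_trivial_iff.1 (continuous_kerFamily_iff.1
      (continuous_id (X := (kerFamily (F₁ × V) (row T C)).Total)))
    have hp := (kerFamily (F₁ × V) (row T C)).continuous_proj
    refine Family.continuous_sum_iff.2 ⟨continuous_kerFamily_iff.2 ?_,
      Family.continuous_trivial_iff.2 ⟨hp, h.2⟩⟩
    exact continuous_bundle_add h.1 (hR.apply hp h.2)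
  · have h₁ := continuous_kerFamily_iff.1
      (Family.continuous_sum_fst (E := kerFamily F₁ T) (E' := Family.trivial X V))
    have h₂ := Family.continuous_trivial_iff.1
      (Family.continuous_sum_snd (E := kerFamily F₁ T) (E' := Family.trivial X V))
    refine continuous_kerFamily_iff.2 (continuous_prod_trivial_iff.2 ⟨?_, h₂.2⟩)
    have h₃ := continuous_bundle_add h₁ (hR.apply h₂.1 h₂.2.neg)
    simp only [Pi.neg_apply, map_neg] at h₃
    exact h₃

variable (T) in
/-- Interchanging the two finite-dimensional summands of the source, on kernels. -/
noncomputable def kerFamilySwap (C : ∀ x, V →L[ℝ] E₂ x) (D : ∀ x, W →L[ℝ] E₂ x) (x : X) :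
    (kerFamily ((F₁ × V) × W) (row (row T C) D)).Fib x →ₗ[ℝ]
      (kerFamily ((F₁ × W) × V) (row (row T D) C)).Fib x :=
  LinearMap.codRestrict _ ((((LinearMap.fst ℝ (E₁ x) V ∘ₗ LinearMap.fst ℝ (E₁ x × V) W).prod
    (LinearMap.snd ℝ (E₁ x × V) W)).prod
      (LinearMap.snd ℝ (E₁ x) V ∘ₗ LinearMap.fst ℝ (E₁ x × V) W)) ∘ₗ
        kerFamilyIncl ((F₁ × V) × W) (row (row T C) D) x) fun a =>
    (add_right_comm _ _ _).trans a.2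

theorem continuous_kerFamilySwap (C : ∀ x, V →L[ℝ] E₂ x) (D : ∀ x, W →L[ℝ] E₂ x) :
    Continuous fun p : (kerFamily ((F₁ × V) × W) (row (row T C) D)).Total =>
      (⟨p.proj, kerFamilySwap T C D p.proj p.snd⟩ :
        (kerFamily ((F₁ × W) × V) (row (row T D) C)).Total) := by
  have h := continuous_prod_trivial_iff.1 (continuous_kerFamily_iff.1
    (continuous_id (X := (kerFamily ((F₁ × V) × W) (row (row T C) D)).Total)))
  have h' := continuous_prod_trivial_iff.1 h.1
  exact continuous_kerFamily_iff.2 (continuous_prod_trivial_iff.2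
    ⟨continuous_prod_trivial_iff.2 ⟨h'.1, h.2⟩, h'.2⟩)

/-- Needed because data for `[T C]` put `W` outside `V`, while the splitting needs `V` outermost.
The inverse is the same swap with `C` and `D` exchanged. -/
theorem kerFamily_row_row_iso (C : ∀ x, V →L[ℝ] E₂ x) (D : ∀ x, W →L[ℝ] E₂ x) :
    (kerFamily ((F₁ × V) × W) (row (row T C) D)).Iso
      (kerFamily ((F₁ × W) × V) (row (row T D) C)) :=
  ⟨fun x => LinearEquiv.ofLinearMap (kerFamilySwap T C D x) (kerFamilySwap T D C x)
    (LinearMap.ext fun _ => rfl) (LinearMap.ext fun _ => rfl),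
    continuous_kerFamilySwap C D, continuous_kerFamilySwap D C⟩

end KernelBundles

/-! ### Classes in the `K`-group. -/

section KGroup

variable {X : Type v} [TopologicalSpace X]

theorem K.mk_congr {E E' : Family.{u} X} (h : E.Iso E') (hE : E.IsLocallyTrivial)
    (hE' : E'.IsLocallyTrivial) : K.mk E hE = K.mk E' hE' :=
  congrArg _ (Quotient.sound h)

theorem K.mk_sum {E E' : Family.{u} X} (hE : E.IsLocallyTrivial) (hE' : E'.IsLocallyTrivial) :
    K.mk (E.sum E') (hE.sum hE') = K.mk E hE + K.mk E' hE' :=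
  (Algebra.GrothendieckAddGroup.of (M := Vect.{u} X)).map_add (Quotient.mk _ ⟨E, hE⟩)
    (Quotient.mk _ ⟨E', hE'⟩)

end KGroup

/-! ### Independence of the auxiliary data and the index formula. -/

section Index

variable {X : Type v} [TopologicalSpace X] [CompactSpace X] [T2Space X]
  {F₁ : Type*} [NormedAddCommGroup F₁] [NormedSpace ℝ F₁] [CompleteSpace F₁]
  {E₁ : X → Type u} [∀ x, AddCommGroup (E₁ x)] [∀ x, Module ℝ (E₁ x)]
  [∀ x, TopologicalSpace (E₁ x)] [TopologicalSpace (TotalSpace F₁ E₁)]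
  [FiberBundle F₁ E₁] [VectorBundle ℝ F₁ E₁]
  {F₂ : Type*} [NormedAddCommGroup F₂] [NormedSpace ℝ F₂] [CompleteSpace F₂]
  {E₂ : X → Type*} [∀ x, AddCommGroup (E₂ x)] [∀ x, Module ℝ (E₂ x)]
  [∀ x, TopologicalSpace (E₂ x)] [TopologicalSpace (TotalSpace F₂ E₂)]
  [FiberBundle F₂ E₂] [VectorBundle ℝ F₂ E₂]
  [∀ x, IsTopologicalAddGroup (E₂ x)] [∀ x, ContinuousSMul ℝ (E₂ x)]
  {V W : Type} [NormedAddCommGroup V] [NormedSpace ℝ V] [FiniteDimensional ℝ V]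
  [NormedAddCommGroup W] [NormedSpace ℝ W] [FiniteDimensional ℝ W]
  {T : ∀ x, E₁ x →L[ℝ] E₂ x}

theorem surjective_row {x : X} (h : Function.Surjective (T x)) (C : ∀ x, V →L[ℝ] E₂ x) :
    Function.Surjective (row T C x) := fun z => by
  obtain ⟨a, rfl⟩ := h z
  refine ⟨(a, 0), ?_⟩
  change T x a + C x 0 = T x a
  rw [map_zero, add_zero]

theorem K.mk_kerFamily_row (hT : IsFredholmBundleMap F₁ F₂ T)
    (hs : ∀ x, Function.Surjective (T x)) {C : ∀ x, V →L[ℝ] E₂ x} (hC : IsLinearBundleMap F₂ C)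
    (h : (kerFamily (F₁ × V) (row T C)).IsLocallyTrivial) :
    K.mk (kerFamily (F₁ × V) (row T C)) h =
      K.mk (kerFamily F₁ T) (isLocallyTrivial_kerFamily hT hs) + K.triv X V :=
  (K.mk_congr (hT.kerFamily_row_iso hs hC) _ _).trans
    (K.mk_sum _ (Family.isLocallyTrivial_trivial V))

/-- Interchanging the roles of two stabilizations: if `[T C]` is surjective, then the kernel of
`[T D C]` is stably that of `[T C]`. -/
theorem K.mk_kerFamily_row_row (hT : IsFredholmBundleMap F₁ F₂ T)
    {C : ∀ x, V →L[ℝ] E₂ x} (hC : IsLinearBundleMap F₂ C)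
    (hs : ∀ x, Function.Surjective (row T C x))
    {D : ∀ x, W →L[ℝ] E₂ x} (hD : IsLinearBundleMap F₂ D)
    (h : (kerFamily ((F₁ × W) × V) (row (row T D) C)).IsLocallyTrivial) :
    K.mk (kerFamily ((F₁ × W) × V) (row (row T D) C)) h =
      K.mk (kerFamily (F₁ × V) (row T C))
        (isLocallyTrivial_kerFamily (isFredholmBundleMap_row hT hC) hs) + K.triv X W := by
  have hTC := isFredholmBundleMap_row hT hC
  rw [← K.mk_kerFamily_row hTC hs hD (isLocallyTrivial_kerFamily
    (isFredholmBundleMap_row hTC hD) fun x => surjective_row (hs x) D)]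
  exact K.mk_congr (kerFamily_row_row_iso D C) _ _

theorem AuxData.isLocallyTrivial_kernel (hT : IsFredholmBundleMap F₁ F₂ T) (A : AuxData F₂ T) :
    (A.kernel F₁).IsLocallyTrivial :=
  isLocallyTrivial_kerFamily (isFredholmBundleMap_row hT A.isLinearBundleMap) A.surjective

/-- Both kernels are compared with that of `T` stabilized by `A` and `A'` together: its class is
`[ker A] + [W']` and also `[ker A'] + [W]`. -/
theorem AuxData.index_eq (hT : IsFredholmBundleMap F₁ F₂ T) (A A' : AuxData F₂ T) :
    K.mk (A.kernel F₁) (A.isLocallyTrivial_kernel hT) -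
        K.triv X (EuclideanSpace ℝ (Fin A.k)) =
      K.mk (A'.kernel F₁) (A'.isLocallyTrivial_kernel hT) -
        K.triv X (EuclideanSpace ℝ (Fin A'.k)) := by
  have hA := isFredholmBundleMap_row hT A.isLinearBundleMap
  have h := isLocallyTrivial_kerFamily (isFredholmBundleMap_row hA A'.isLinearBundleMap)
    fun x => surjective_row (A.surjective x) A'.map
  have h₁ := K.mk_kerFamily_row hA A.surjective A'.isLinearBundleMap h
  have h₂ := K.mk_kerFamily_row_row hT A'.isLinearBundleMap A'.surjective A.isLinearBundleMap h
  rw [sub_eq_sub_iff_add_eq_add]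
  exact h₁.symm.trans h₂

theorem AuxData.isIndex (hT : IsFredholmBundleMap F₁ F₂ T) (A : AuxData F₂ T) :
    IsIndex F₁ F₂ T (K.mk (A.kernel F₁) (A.isLocallyTrivial_kernel hT) -
      K.triv X (EuclideanSpace ℝ (Fin A.k))) :=
  ⟨⟨A⟩, fun A' => ⟨A'.isLocallyTrivial_kernel hT, A'.index_eq hT A⟩⟩

theorem IsFredholmBundleMap.isIndex_ind (hT : IsFredholmBundleMap F₁ F₂ T) :
    IsIndex F₁ F₂ T (ind F₁ F₂ T) := by
  obtain ⟨A⟩ := hT.nonempty_auxData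
  have h : ∃ ξ, IsIndex F₁ F₂ T ξ := ⟨_, A.isIndex hT⟩
  -- Since the index exists, the default value `0` of `ind` does not occur.
  rw [ind, dif_pos h]
  exact h.choose_spec

theorem AuxData.ind_eq (hT : IsFredholmBundleMap F₁ F₂ T) (A : AuxData F₂ T) :
    ind F₁ F₂ T = K.mk (A.kernel F₁) (A.isLocallyTrivial_kernel hT) -
      K.triv X (EuclideanSpace ℝ (Fin A.k)) :=
  (hT.isIndex_ind.2 A).choose_spec.symm

/-- Auxiliary data for `T` are auxiliary data for `[T C]`. -/
def AuxData.row (A : AuxData F₂ T) (C : ∀ x, V →L[ℝ] E₂ x) : AuxData F₂ (row T C) where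
  k := A.k
  map := A.map
  isLinearBundleMap := A.isLinearBundleMap
  surjective x z := by
    obtain ⟨⟨a, w⟩, rfl⟩ := A.surjective x z
    refine ⟨((a, 0), w), ?_⟩
    change T x a + C x 0 + A.map x w = T x a + A.map x w
    rw [map_zero, add_zero]

/-- Both indices are computed from the same `A`, so the trivial class `[W]` subtracted is the same,
and only the kernels, which differ by `[V]`, need comparing. -/
theorem ind_row (hT : IsFredholmBundleMap F₁ F₂ T) {C : ∀ x, V →L[ℝ] E₂ x}
    (hC : IsLinearBundleMap F₂ C) :
    ind (F₁ × V) F₂ (row T C) = ind F₁ F₂ T + K.triv X V := by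
  obtain ⟨A⟩ := hT.nonempty_auxData
  have hTC := isFredholmBundleMap_row hT hC
  have h := K.mk_kerFamily_row_row hT A.isLinearBundleMap A.surjective hC
    ((A.row C).isLocallyTrivial_kernel hTC)
  rw [A.ind_eq hT, (A.row C).ind_eq hTC, sub_add_eq_add_sub]
  exact congrArg (· - K.triv X (EuclideanSpace ℝ (Fin A.k))) h

end Index

end KTheory

theorem lemma8p9 {X : Type v} [TopologicalSpace X] [CompactSpace X] [T2Space X]
    {F₁ : Type*} [NormedAddCommGroup F₁] [NormedSpace ℝ F₁] [CompleteSpace F₁]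
    {E₁ : X → Type u} [∀ x, AddCommGroup (E₁ x)] [∀ x, Module ℝ (E₁ x)]
    [∀ x, TopologicalSpace (E₁ x)] [TopologicalSpace (TotalSpace F₁ E₁)]
    [FiberBundle F₁ E₁] [VectorBundle ℝ F₁ E₁]
    {F₂ : Type*} [NormedAddCommGroup F₂] [NormedSpace ℝ F₂] [CompleteSpace F₂]
    {E₂ : X → Type*} [∀ x, AddCommGroup (E₂ x)] [∀ x, Module ℝ (E₂ x)]
    [∀ x, TopologicalSpace (E₂ x)] [TopologicalSpace (TotalSpace F₂ E₂)]
    [FiberBundle F₂ E₂] [VectorBundle ℝ F₂ E₂]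
    [∀ x, IsTopologicalAddGroup (E₂ x)] [∀ x, ContinuousSMul ℝ (E₂ x)]
    {V : Type} [NormedAddCommGroup V] [NormedSpace ℝ V] [FiniteDimensional ℝ V]
    (B : ∀ x, E₁ x →L[ℝ] E₂ x) (hB : KTheory.IsFredholmBundleMap F₁ F₂ B)
    (C : ∀ x, V →L[ℝ] E₂ x) (hC : KTheory.IsLinearBundleMap F₂ C) :
    KTheory.IsFredholmBundleMap (F₁ × V) F₂ (KTheory.row B C) ∧
    KTheory.IsIndex F₁ F₂ B (KTheory.ind F₁ F₂ B) ∧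
    KTheory.IsIndex (F₁ × V) F₂ (KTheory.row B C) (KTheory.ind (F₁ × V) F₂ (KTheory.row B C)) ∧
    KTheory.ind (F₁ × V) F₂ (KTheory.row B C) =
      KTheory.ind F₁ F₂ B + KTheory.K.triv X V := by
  have hBC := KTheory.isFredholmBundleMap_row hB hC
  exact ⟨hBC, hB.isIndex_ind, hBC.isIndex_ind, KTheory.ind_row hB hC⟩
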